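/- Let $n\ge 2$ be an integer and let $\pi$ be a uniform random permutation in the symmetric group $\mathfrak S_n$. Put \[ a_i=i-\frac{n+1}{2}\ (1\le i\le n),\qquad c_n=\frac{12}{n(n^2-1)},\qquad \rho_n(\pi)=c_n\sum_{i=1}^n a_i a_{\pi(i)} \] (Spearman's $\rho$), and for integers $r\ge 0$ let $M_r(n)=\mathbb E\{\rho_n(\pi)^r\}=\frac1{n!}\sum_{\sigma\in\mathfrak S_n}\rho_n(\sigma)^r$. For an integer partition $\lambda=(\lambda_1\ge\cdots\ge\lambda_\ell\ge 1)$ of $r$ let $\ell(\lambda)=\ell$, let $m_j(\lambda)$ be the number of parts equal to $j$, and let \[ D_\lambda(n)=\sum_{\substack{1\le i_1,\dots,i_\ell\le n\\ \text{pairwise distinct}}}\ \prod_{b=1}^{\ell}a_{i_b}^{\lambda_b},\qquad (n)_\ell=n(n-1)\cdots(n-\ell+1). \] Then for every $r\ge 0$ \[ M_r(n)=c_n^r\sum_{\lambda\vdash r}\frac{r!}{\prod_{b=1}^{\ell(\lambda)}\lambda_b!\,\prod_{j\ge1}m_j(\lambda)!}\cdot\frac{D_\lambda(n)^2}{(n)_{\ell(\lambda)}},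 \] where the terms with $\ell(\lambda)>n$, for which $D_\lambda(n)=0$ and $(n)_{\ell(\lambda)}=0$, are read as $0$. Moreover \[ M_4(n)=\frac{3(25n^3-38n^2-35n+72)}{25n(n-1)^3(n+1)},\qquad M_6(n)=\frac{3P_6(n)}{245n^3(n-1)^5(n+1)^3}, \] and \[ \operatorname{Var}\{\rho_n(\pi)^4\}=M_8(n)-M_4(n)^2=\frac{24(n-2)Q_4(n)}{4375n^5(n-1)^7(n+1)^5}, \] \[ \operatorname{Var}\{\rho_n(\pi)^6\}=M_{12}(n)-M_6(n)^2=\frac{18(n-2)Q_6(n)}{2789661875n^9(n-1)^{11}(n+1)^9}, \] where \[ P_6(n)=1225n^8-4361n^7-178n^6+23818n^5-22783n^4-50081n^3+54280n^2+44160n-28800, \] \[ Q_4(n)=17500n^{12}-99575n^{11}+93952n^{10}+857943n^9-2236650n^8-3105081n^7+12836468n^6+8558537n^5-32726710n^4-20519664n^3+28279440n^2+9858240n-12700800, \] \[ \begin{aligned} Q_6(n)={}&1576158959375n^{22}-26956502698125n^{21}+204016193881500n^{20}-656132617822682n^{19}\\ &-1171932384888603n^{18}+16913917053629829n^{17}-33663135573263722n^{16}-143066811467638476n^{15}\\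 &+610987613264235129n^{14}+596842447834386253n^{13}-5189139972464602944n^{12}-1409441833203864570n^{11}\\ &+27750786105920376371n^{10}+4444828679768649627n^9-95698023681505100946n^8-19996738740525207104n^7\\ &+206938856876542180608n^6+34634552355461373696n^5-313861911687028044288n^4-56314087053512122368n^3\\ &+270499002102369976320n^2+37528151745373470720n-101439305560276992000. \end{aligned} \] -/

import Mathlib

open MeasureTheory

/-- The finite symmetric group carries the discrete σ-algebra. -/
instance permMeasurableSpace (n : ℕ) : MeasurableSpace (Equiv.Perm (Fin n)) := ⊤

instance permDiscreteMeasurableSpace (n : ℕ) :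
    DiscreteMeasurableSpace (Equiv.Perm (Fin n)) := ⟨fun _ => trivial⟩

namespace SpearmanMoments

noncomputable section

/-- The law of a uniform random permutation of `n` objects. -/
def uniformPerm (n : ℕ) : Measure (Equiv.Perm (Fin n)) :=
  (PMF.uniformOfFintype (Equiv.Perm (Fin n))).toMeasure

/-- The centered rank `i - (n + 1) / 2` for `i = 1, …, n`; the rank `i` is represented by the
element `i - 1` of `Fin n`. -/
def centeredRank (n : ℕ) (i : Fin n) : ℝ := ((i : ℕ) + 1 : ℝ) - ((n : ℝ) + 1) / 2

/-- The normalizing constant `12 / (n (n ^ 2 - 1))`. -/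
def normConst (n : ℕ) : ℝ := 12 / ((n : ℝ) * ((n : ℝ) ^ 2 - 1))

/-- Spearman's rank correlation of the rank sequences `(1, …, n)` and `(π 1, …, π n)`. -/
def rho (n : ℕ) (π : Equiv.Perm (Fin n)) : ℝ :=
  normConst n * ∑ i : Fin n, centeredRank n i * centeredRank n (π i)

/-- The `r`-th moment of Spearman's rho under a uniform random permutation. -/
def rhoMoment (n r : ℕ) : ℝ := ∫ π, rho n π ^ r ∂(uniformPerm n)

/-- The parts `λ₁ ≥ ⋯ ≥ λ_ℓ` of an integer partition, listed in decreasing order. -/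
def partsList {r : ℕ} (lam : r.Partition) : List ℕ := lam.parts.sort (· ≥ ·)

/-- The number of parts `ℓ(λ)`. -/
def len {r : ℕ} (lam : r.Partition) : ℕ := (partsList lam).length

/-- The ordered distinct-index power sum `D_λ(n)`: the sum of `∏ b, a_{i_b} ^ λ_b` over all tuples
`(i_1, …, i_ℓ)` of pairwise distinct indices, that is, over all injections `i` from the positions
`1, …, ℓ` to the indices `1, …, n`. -/
def distinctPowerSum (n : ℕ) {r : ℕ} (lam : r.Partition) : ℝ :=
  ∑ i : Fin (len lam) ↪ Fin n, ∏ b : Fin (len lam), centeredRank n (i b) ^ (partsList lam).get b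

/-- The number `r! / (∏ b, λ_b! * ∏ j, m_j(λ)!)`, where `m_j(λ)` is the multiplicity of the part
`j`; the second product runs over the values `j` that occur, the other factors being `0! = 1`. -/
def partitionCoeff {r : ℕ} (lam : r.Partition) : ℝ :=
  (r.factorial : ℝ) /
    ((∏ b : Fin (len lam), (((partsList lam).get b).factorial : ℝ)) *
      ∏ j ∈ lam.parts.toFinset, ((lam.parts.count j).factorial : ℝ))

/-- The polynomial in the numerator of the sixth moment. -/
def P6 (x : ℝ) : ℝ :=
  1225 * x ^ 8 - 4361 * x ^ 7 - 178 * x ^ 6 + 23818 * x ^ 5 - 22783 * x ^ 4 - 50081 * x ^ 3 +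
    54280 * x ^ 2 + 44160 * x - 28800

/-- The polynomial in the numerator of the variance of the fourth power. -/
def Q4 (x : ℝ) : ℝ :=
  17500 * x ^ 12 - 99575 * x ^ 11 + 93952 * x ^ 10 + 857943 * x ^ 9 - 2236650 * x ^ 8 -
    3105081 * x ^ 7 + 12836468 * x ^ 6 + 8558537 * x ^ 5 - 32726710 * x ^ 4 -
    20519664 * x ^ 3 + 28279440 * x ^ 2 + 9858240 * x - 12700800

/-- The polynomial in the numerator of the variance of the sixth power. -/
def Q6 (x : ℝ) : ℝ :=
  1576158959375 * x ^ 22 - 26956502698125 * x ^ 21 + 204016193881500 * x ^ 20 -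
    656132617822682 * x ^ 19 - 1171932384888603 * x ^ 18 + 16913917053629829 * x ^ 17 -
    33663135573263722 * x ^ 16 - 143066811467638476 * x ^ 15 + 610987613264235129 * x ^ 14 +
    596842447834386253 * x ^ 13 - 5189139972464602944 * x ^ 12 - 1409441833203864570 * x ^ 11 +
    27750786105920376371 * x ^ 10 + 4444828679768649627 * x ^ 9 -
    95698023681505100946 * x ^ 8 - 19996738740525207104 * x ^ 7 +
    206938856876542180608 * x ^ 6 + 34634552355461373696 * x ^ 5 -
    313861911687028044288 * x ^ 4 - 56314087053512122368 * x ^ 3 +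
    270499002102369976320 * x ^ 2 + 37528151745373470720 * x - 101439305560276992000

end

end SpearmanMoments

/-! Partition formula: expand the `r`-th power of `∑ a, x a * x (π a)` by the multinomial theorem
and group monomials by their exponents' partition (`sum_pow_eq_sum_partition`). For a fixed
injective tuple `i`, a uniform `π` makes `π ∘ i` uniform among injective tuples. The average over
`π` therefore separates into two copies of `D_λ`, divided by the number `(n)_ℓ` of tuples
(`sum_perm_embeddingSum`).

Closed forms: the same average is applied to an expansion that can be computed, `powerExpansion`,
built by repeated multiplication by the first power sum. Multiplying a distinct-index sum by a power
sum adds a new index or merges it with an old one (`distinctSum_merges`). Solved for the longest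
term, this is a recursion for `D_l = (n)_ℓ E_l`, where each `E_l` is found by exact division by `X -
ℓ`. Then `D_l ^ 2 / (n)_ℓ = (n)_ℓ E_l ^ 2` is a polynomial in `n`, even where `(n)_ℓ` vanishes.

The ranks are scaled by `30030 = 2·3·5·7·11·13`, which clears the denominators of the power-sum
polynomials used. The divisors `X - ℓ` are monic, so all coefficients stay integral, and each closed
form becomes an identity of integer coefficient lists, evaluated by the kernel. The computation need
only be sound: a failed lookup or an inexact division yields `none`. -/

namespace SpearmanMoments

/-! ### Integer polynomials as coefficient lists -/

/-- Sum of two coefficient lists. -/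
def polyAdd : List ℤ → List ℤ → List ℤ
  | [], q => q
  | a :: p, [] => a :: p
  | a :: p, b :: q => (a + b) :: polyAdd p q

/-- Scalar multiple of a coefficient list. -/
def polyScale (c : ℤ) (p : List ℤ) : List ℤ := p.map (c * ·)

/-- Product of two coefficient lists. -/
def polyMul : List ℤ → List ℤ → List ℤ
  | [], _ => []
  | a :: p, q => polyAdd (polyScale a q) (0 :: polyMul p q)

/-- Power of a coefficient list. -/
def polyPow (p : List ℤ) : ℕ → List ℤ
  | 0 => [1]
  | k + 1 => polyMul p (polyPow p k)

/-- Quotient and remainder of a coefficient list by `X - a`. -/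
def polyDivMod (a : ℤ) : List ℤ → List ℤ × ℤ
  | [] => ([], 0)
  | c :: p =>
    let d := polyDivMod a p
    (if d.1 = [] ∧ d.2 = 0 then [] else d.2 :: d.1, c + a * d.2)

/-- The coefficient list of `X (X - 1) ⋯ (X - ℓ + 1)`. -/
def polyFalling : ℕ → List ℤ
  | 0 => [1]
  | l + 1 => polyMul (polyFalling l) [-(l : ℤ), 1]

/-! ### Merging parts and expanding powers -/

/-- The lists that arise from `l` by adding `k` to one entry. -/
def merges (k : ℕ) : List ℕ → List (List ℕ)
  | [] => []
  | h :: t => ((k + h) :: t) :: (merges k t).map (h :: ·)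

/-- Boolean equality of lists of natural numbers. -/
def sameList : List ℕ → List ℕ → Bool
  | [], [] => true
  | a :: l, b :: m => cond (Nat.beq a b) (sameList l m) false
  | _, _ => false

/-- A decidable total order on lists, used to keep the expansions sorted. -/
def lexBefore : List ℕ → List ℕ → Bool
  | [], _ => false
  | _ :: _, [] => true
  | a :: l, b :: m => cond (Nat.beq a b) (lexBefore l m) (Nat.blt b a)

/-- Add the multiple `c` of `l` to a formal sum of lists. -/
def addTerm (l : List ℕ) (c : ℕ) : List (List ℕ × ℕ) → List (List ℕ × ℕ)
  | [] => [(l, c)]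
  | t :: T =>
    cond (sameList l t.1) ((l, t.2 + c) :: T)
      (cond (lexBefore l t.1) ((l, c) :: t :: T) (t :: addTerm l c T))

/-- The formal sum of distinct-index power sums equal to the `r`-th power of the first one. -/
def powerExpansion : ℕ → List (List ℕ × ℕ)
  | 0 => [([], 1)]
  | r + 1 => (powerExpansion r).foldr (fun t T =>
      addTerm (1 :: t.1) t.2 ((merges 1 t.1).foldr
        (fun m U => addTerm (m.insertionSort (· ≤ ·)) t.2 U) T)) []

/-! ### Tables of normalized distinct-index power sums -/

/-- Look up the entry of a list of exponents. -/
def tableFind (T : List (List ℕ × List ℤ)) (l : List ℕ) : Option (List ℤ) :=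
  match T with
  | [] => none
  | t :: T => cond (sameList l t.1) (some t.2) (tableFind T l)

/-- The sum of the entries of several lists of exponents. -/
def tableSum (T : List (List ℕ × List ℤ)) : List (List ℕ) → Option (List ℤ)
  | [] => some []
  | l :: L =>
    match tableFind T (l.insertionSort (· ≤ ·)), tableSum T L with
    | some p, some q => some (polyAdd p q)
    | _, _ => none

/-- The entry of a list of exponents, computed from the entries of shorter lists: those of the
same weight in `T`, and those of lower weight in `prev`. -/
def tableEntry (s : ℕ → Option (List ℤ)) (prev : List (List (List ℕ × List ℤ)))
    (T : List (List ℕ × List ℤ)) : List ℕ → Option (List ℤ)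
  | [] => some [1]
  | k :: l =>
    match s k, tableSum T (merges k l) with
    | some u, some q =>
      -- `prev` starts one weight below `k :: l`, so weight `|l|` sits at position `k - 1`. A
      -- vanishing power sum makes this entry irrelevant.
      match (if u = [] then some [] else tableFind (prev.getD (k - 1) []) l) with
      | some p =>
        let d := polyDivMod l.length (polyAdd (polyMul u p) (polyScale (-1) q))
        if d.2 = 0 then some d.1 else none
      | none => none
    | _, _ => none

/-- Extend a table by the entry of a list of exponents. -/
def tableExtend (s : ℕ → Option (List ℤ)) (prev : List (List (List ℕ × List ℤ)))
    (T : List (List ℕ × List ℤ)) (l : List ℕ) : List (List ℕ × List ℤ) :=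
  match tableEntry s prev T l with
  | some p => (l, p) :: T
  | none => T

/-- The tables of the weights `r, r - 1, …, 0`. -/
def tables (s : ℕ → Option (List ℤ)) : ℕ → List (List (List ℕ × List ℤ))
  | 0 => [[([], [1])]]
  | r + 1 =>
    let prev := tables s r
    -- In the order of `lexBefore` a sorted list comes after all merges of its head into its tail,
    -- so the entries it needs are already present.
    (powerExpansion (r + 1)).foldl (fun T t => tableExtend s prev T t.1) [] :: prev

/-- The sum of `c (X)_ℓ E²` over the terms of a formal sum, `E` being the table entries. -/
def momentSum (T : List (List ℕ × List ℤ)) : List (List ℕ × ℕ) → Option (List ℤ)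
  | [] => some []
  | t :: L =>
    match tableFind T t.1, momentSum T L with
    | some p, some q =>
      some (polyAdd (polyScale t.2 (polyMul (polyFalling t.1.length) (polyMul p p))) q)
    | _, _ => none

/-- The polynomial that gives the `r`-th moment of the unnormalized statistic. -/
def momentPoly (s : ℕ → Option (List ℤ)) (r : ℕ) : Option (List ℤ) :=
  momentSum ((tables s r).getD 0 []) (powerExpansion r)

/-- The power sums of the centered ranks, scaled by `30030 ^ k`. -/
def rankPowerSum : ℕ → Option (List ℤ)
  | 2 => some <| polyScale (30030 ^ 2 / 12) [0, -1, 0, 1]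
  | 4 => some <| polyScale (30030 ^ 4 / 240) [0, 7, 0, -10, 0, 3]
  | 6 => some <| polyScale (30030 ^ 6 / 1344) [0, -31, 0, 49, 0, -21, 0, 3]
  | 8 => some <| polyScale (30030 ^ 8 / 11520) [0, 381, 0, -620, 0, 294, 0, -60, 0, 5]
  | 10 => some <| polyScale (30030 ^ 10 / 33792) [0, -2555, 0, 4191, 0, -2046, 0, 462, 0, -55, 0, 3]
  | 12 => some <| polyScale (30030 ^ 12 / 5591040)
      [0, 1414477, 0, -2325050, 0, 1144143, 0, -265980, 0, 35035, 0, -2730, 0, 105]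
  | 1 | 3 | 5 | 7 | 9 | 11 => some []
  | _ => none

/-! ### Evaluation of coefficient lists at real numbers -/

/-- The value of a coefficient list at a real number. -/
def polyEval (x : ℝ) : List ℤ → ℝ
  | [] => 0
  | c :: p => c + x * polyEval x p

theorem polyEval_add (x : ℝ) : ∀ p q, polyEval x (polyAdd p q) = polyEval x p + polyEval x q
  | [], q => by simp [polyAdd, polyEval]
  | a :: p, [] => by simp [polyAdd, polyEval]
  | a :: p, b :: q => by
    simp only [polyAdd, polyEval, polyEval_add x p q]; push_cast; ring

theorem polyEval_scale (x : ℝ) (c : ℤ) (p : List ℤ) :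
    polyEval x (polyScale c p) = c * polyEval x p := by
  induction p with
  | nil => simp [polyScale, polyEval]
  | cons a p ih =>
    rw [polyScale] at ih
    simp only [polyScale, List.map_cons, polyEval, ih]; push_cast; ring

theorem polyEval_mul (x : ℝ) (p q : List ℤ) :
    polyEval x (polyMul p q) = polyEval x p * polyEval x q := by
  induction p with
  | nil => simp [polyMul, polyEval]
  | cons a p ih =>
    simp only [polyMul, polyEval_add, polyEval_scale, polyEval, ih]; push_cast; ring

theorem polyEval_pow (x : ℝ) (p : List ℤ) (k : ℕ) :
    polyEval x (polyPow p k) = polyEval x p ^ k := by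
  induction k with
  | zero => simp [polyPow, polyEval]
  | succ k ih => rw [polyPow, polyEval_mul, ih, pow_succ']

/-- Synthetic division: if `p = (X - a) q + d`, then `c + X p = (X - a) (d + X q) + (c + a d)`. The
special case only avoids a trailing zero. -/
theorem polyEval_divMod (x : ℝ) (a : ℤ) (p : List ℤ) :
    polyEval x p = (x - a) * polyEval x (polyDivMod a p).1 + (polyDivMod a p).2 := by
  induction p with
  | nil => simp [polyDivMod, polyEval]
  | cons c p ih =>
    simp only [polyDivMod, polyEval]
    rw [ih]
    split_ifs with h
    · simp [h.1, h.2, polyEval]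
    · simp only [polyEval]; push_cast; ring

theorem polyEval_falling (n l : ℕ) : polyEval n (polyFalling l) = n.descFactorial l := by
  induction l with
  | zero => simp [polyFalling, polyEval]
  | succ l ih =>
    rw [polyFalling, polyEval_mul, ih, Nat.descFactorial_succ]
    simp only [polyEval]
    -- For `l > n` the natural subtraction `n - l` truncates, but the falling factorial is already
    -- zero.
    rcases le_or_gt l n with h | h
    · push_cast [Nat.cast_sub h]; ring
    · simp [Nat.descFactorial_eq_zero_iff_lt.2 h]

/-! ### Distinct-index power sums -/

section DistinctSum

variable {α : Type*} [Fintype α] [DecidableEq α]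

/-- The sum of `∏ b, x_{i_b} ^ l_b` over the tuples of pairwise distinct indices outside `s`. -/
def distinctSum (x : α → ℝ) : List ℕ → Finset α → ℝ
  | [], _ => 1
  | k :: l, s => ∑ i ∈ sᶜ, x i ^ k * distinctSum x l (insert i s)

theorem sum_compl_comm (s : Finset α) (f : α → α → ℝ) :
    ∑ i ∈ sᶜ, ∑ j ∈ (insert i s)ᶜ, f i j = ∑ j ∈ sᶜ, ∑ i ∈ (insert j s)ᶜ, f i j := by
  refine Finset.sum_comm' fun i j => ?_
  simp only [Finset.mem_compl, Finset.mem_insert]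
  tauto

theorem distinctSum_swap (x : α → ℝ) (h k : ℕ) (l : List ℕ) (s : Finset α) :
    distinctSum x (h :: k :: l) s = distinctSum x (k :: h :: l) s := by
  simp only [distinctSum, Finset.mul_sum]
  rw [sum_compl_comm]
  refine Finset.sum_congr rfl fun i _ => Finset.sum_congr rfl fun j _ => ?_
  rw [Finset.insert_comm]; ring

theorem distinctSum_perm (x : α → ℝ) {l m : List ℕ} (h : l.Perm m) (s : Finset α) :
    distinctSum x l s = distinctSum x m s := by
  induction h generalizing s with
  | nil => rfl
  | cons k _ ih => simp only [distinctSum, ih]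
  | swap h k l => exact distinctSum_swap x k h l s
  | trans _ _ h₁ h₂ => rw [h₁, h₂]

/-- The extra index either differs from all indices of the tuple or equals exactly one of them,
whose exponent then grows by `k`. -/
theorem distinctSum_merges (x : α → ℝ) (k : ℕ) (l : List ℕ) (s : Finset α) :
    (∑ i ∈ sᶜ, x i ^ k) * distinctSum x l s =
      distinctSum x (k :: l) s + ((merges k l).map (distinctSum x · s)).sum := by
  induction l generalizing s with
  | nil => simp [distinctSum, merges]
  | cons h t ih =>
    have split : ∀ j ∈ sᶜ, (∑ i ∈ sᶜ, x i ^ k) = x j ^ k + ∑ i ∈ (insert j s)ᶜ, x i ^ k := by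
      intro j hj
      rw [Finset.compl_insert]
      exact (Finset.add_sum_erase _ (fun i => x i ^ k) hj).symm
    have tail : ∀ L : List (List ℕ), ((L.map (h :: ·)).map (distinctSum x · s)).sum =
        ∑ j ∈ sᶜ, x j ^ h * (L.map (distinctSum x · (insert j s))).sum := by
      intro L
      induction L with
      | nil => simp
      | cons m L ihL =>
        simp only [List.map_cons, List.sum_cons, ihL, mul_add, Finset.sum_add_distrib]
        rfl
    rw [merges, List.map_cons, List.sum_cons, tail, distinctSum_swap]
    simp only [distinctSum]
    rw [Finset.mul_sum, ← Finset.sum_add_distrib, ← Finset.sum_add_distrib]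
    refine Finset.sum_congr rfl fun j hj => ?_
    have := ih (insert j s)
    simp only [distinctSum] at this
    rw [split j hj, pow_add]
    linear_combination x j ^ h * this

/-! ### Correctness of the expansions -/

/-- The value of a formal sum of lists. -/
def expansionValue (f : List ℕ → ℝ) (T : List (List ℕ × ℕ)) : ℝ :=
  (T.map fun t => t.2 * f t.1).sum

theorem sameList_eq : ∀ {l m : List ℕ}, sameList l m = true → l = m
  | [], [], _ => rfl
  | a :: l, b :: m, h => by
    rw [sameList] at h
    cases hab : Nat.beq a b with
    | false => simp [hab] at h
    | true =>
      rw [hab, cond_true] at h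
      rw [Nat.eq_of_beq_eq_true hab, sameList_eq h]

theorem expansionValue_addTerm (f : List ℕ → ℝ) (l : List ℕ) (c : ℕ) (T : List (List ℕ × ℕ)) :
    expansionValue f (addTerm l c T) = c * f l + expansionValue f T := by
  induction T with
  | nil => simp [addTerm, expansionValue]
  | cons t T ih =>
    simp only [expansionValue] at ih
    rw [addTerm]
    cases h : sameList l t.1 with
    | true =>
      rw [sameList_eq h]
      simp only [cond_true, expansionValue, List.map_cons, List.sum_cons]
      push_cast; ring
    | false =>
      cases lexBefore l t.1 <;> simp [expansionValue, ih]; ring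

/-- Each multiplication by `∑ i, x i` is `distinctSum_merges` with `k = 1`; sorting the merged lists
is harmless by symmetry. -/
theorem expansionValue_powerExpansion (x : α → ℝ) (r : ℕ) :
    expansionValue (distinctSum x · ∅) (powerExpansion r) = (∑ i, x i) ^ r := by
  induction r with
  | zero => simp [powerExpansion, expansionValue, distinctSum]
  | succ r ih =>
    have inner : ∀ (c : ℕ) (L : List (List ℕ)) (T : List (List ℕ × ℕ)),
        expansionValue (distinctSum x · ∅)
          (L.foldr (fun m U => addTerm (m.insertionSort (· ≤ ·)) c U) T) =
        c * (L.map (distinctSum x · ∅)).sum + expansionValue (distinctSum x · ∅) T := by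
      intro c L T
      induction L with
      | nil => simp
      | cons m L ihL =>
        rw [List.foldr_cons, expansionValue_addTerm, ihL,
          distinctSum_perm x (List.perm_insertionSort _ m)]
        simp only [List.map_cons, List.sum_cons]; ring
    have outer : ∀ T : List (List ℕ × ℕ),
        expansionValue (distinctSum x · ∅) (T.foldr (fun t T =>
          addTerm (1 :: t.1) t.2 ((merges 1 t.1).foldr
            (fun m U => addTerm (m.insertionSort (· ≤ ·)) t.2 U) T)) []) =
        (∑ i, x i) * expansionValue (distinctSum x · ∅) T := by
      intro T
      induction T with
      | nil => simp [expansionValue]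
      | cons t T ihT =>
        rw [List.foldr_cons, expansionValue_addTerm, inner, ihT]
        have := distinctSum_merges x 1 t.1 ∅
        simp only [Finset.compl_empty, pow_one] at this
        simp only [expansionValue, List.map_cons, List.sum_cons]
        linear_combination -(t.2 : ℝ) * this
    rw [powerExpansion, outer, ih, pow_succ']

/-! ### Correctness of the tables -/

/-- The polynomial `p` gives the distinct-index power sum of `l`, up to a falling factorial. -/
def IsNormalized (x : α → ℝ) (l : List ℕ) (p : List ℤ) : Prop :=
  distinctSum x l ∅ =
    (Fintype.card α).descFactorial l.length * polyEval (Fintype.card α) p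

/-- All entries of a table are correct. -/
def IsTable (x : α → ℝ) (T : List (List ℕ × List ℤ)) : Prop :=
  ∀ t ∈ T, IsNormalized x t.1 t.2

theorem IsTable.find {x : α → ℝ} {T : List (List ℕ × List ℤ)} (hT : IsTable x T) {l : List ℕ}
    {p : List ℤ} (h : tableFind T l = some p) : IsNormalized x l p := by
  induction T with
  | nil => simp [tableFind] at h
  | cons t T ih =>
    rw [tableFind] at h
    cases hs : sameList l t.1 with
    | true =>
      rw [hs, cond_true, Option.some.injEq] at h
      rw [sameList_eq hs, ← h]
      exact hT t (by simp)
    | false =>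
      rw [hs, cond_false] at h
      exact ih (fun u hu => hT u (by simp [hu])) h

theorem IsTable.sum {x : α → ℝ} {T : List (List ℕ × List ℤ)} (hT : IsTable x T) (c : ℕ)
    (L : List (List ℕ)) (hL : ∀ m ∈ L, m.length = c) {p : List ℤ} (h : tableSum T L = some p) :
    (L.map (distinctSum x · ∅)).sum =
      (Fintype.card α).descFactorial c * polyEval (Fintype.card α) p := by
  induction L generalizing p with
  | nil =>
    simp only [tableSum, Option.some.injEq] at h
    simp [← h, polyEval]
  | cons l L ih =>
    rw [tableSum] at h
    split at h
    · rename_i q r hq hr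
      rw [Option.some.injEq] at h
      have h₁ := hT.find hq
      rw [IsNormalized, distinctSum_perm x (List.perm_insertionSort _ l), List.length_insertionSort,
        hL l (by simp)] at h₁
      rw [List.map_cons, List.sum_cons, h₁, ih (fun m hm => hL m (by simp [hm])) hr, ← h,
        polyEval_add]
      ring
    · simp at h

theorem length_of_mem_merges {k : ℕ} {l m : List ℕ} (h : m ∈ merges k l) :
    m.length = l.length := by
  induction l generalizing m with
  | nil => simp [merges] at h
  | cons a l ih =>
    simp only [merges, List.mem_cons, List.mem_map] at h
    rcases h with rfl | ⟨u, hu, rfl⟩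
    · simp
    · simp [ih hu]

/-- With `ℓ = l.length`, the merging identity reads `D_{k :: l} = (n)_ℓ (u p₁ - q)`, because all
merges have length `ℓ`. Exact division turns the bracket into `(n - ℓ) E`, and `(n)_ℓ (n - ℓ) =
(n)_{ℓ+1}`. Nothing is divided over the reals, so small `n` are covered. -/
theorem isNormalized_tableEntry {x : α → ℝ} {s : ℕ → Option (List ℤ)}
    (hs : ∀ k u, s k = some u → ∑ i, x i ^ k = polyEval (Fintype.card α) u)
    {prev : List (List (List ℕ × List ℤ))} (hprev : ∀ T ∈ prev, IsTable x T)
    {T : List (List ℕ × List ℤ)} (hT : IsTable x T) {l : List ℕ} {p : List ℤ}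
    (h : tableEntry s prev T l = some p) : IsNormalized x l p := by
  cases l with
  | nil =>
    simp only [tableEntry, Option.some.injEq] at h
    simp [IsNormalized, distinctSum, ← h, polyEval]
  | cons k l =>
    rw [tableEntry] at h
    split at h
    · rename_i u q hu hq
      split at h
      · rename_i p₁ hp
        simp only [Option.ite_none_right_eq_some, Option.some.injEq] at h
        obtain ⟨h₀, rfl⟩ := h
        have hmain : (∑ i, x i ^ k) * distinctSum x l ∅ =
            (Fintype.card α).descFactorial l.length *
              (polyEval (Fintype.card α) u * polyEval (Fintype.card α) p₁) := by
          rw [hs k u hu]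
          split_ifs at hp with h0
          · simp [h0, polyEval]
          · have : IsTable x (prev.getD (k - 1) []) := by
              rw [List.getD_eq_getElem?_getD]
              cases hg : prev[k - 1]? with
              | none => simp [IsTable]
              | some U => exact hprev U (List.mem_of_getElem? hg)
            have h₁ := this.find hp
            rw [IsNormalized] at h₁
            rw [h₁]; ring
        have hsum := hT.sum l.length _ (fun m hm => length_of_mem_merges hm) hq
        have hrec := distinctSum_merges x k l ∅
        rw [Finset.compl_empty, hmain, hsum] at hrec
        have hdiv := polyEval_divMod (Fintype.card α) l.length
          (polyAdd (polyMul u p₁) (polyScale (-1) q))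
        rw [h₀, polyEval_add, polyEval_mul, polyEval_scale] at hdiv
        have hfall : (((Fintype.card α).descFactorial (l.length + 1) : ℕ) : ℝ) =
            (Fintype.card α - l.length) * (Fintype.card α).descFactorial l.length := by
          rw [← polyEval_falling, ← polyEval_falling, polyFalling, polyEval_mul]
          simp only [polyEval]; push_cast; ring
        rw [IsNormalized, List.length_cons, hfall]
        push_cast at hdiv
        linear_combination ((Fintype.card α).descFactorial l.length : ℝ) * hdiv - hrec
      · simp at h
    · simp at h

theorem isTable_of_mem_tables {x : α → ℝ} {s : ℕ → Option (List ℤ)}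
    (hs : ∀ k u, s k = some u → ∑ i, x i ^ k = polyEval (Fintype.card α) u) (r : ℕ) :
    ∀ T ∈ tables s r, IsTable x T := by
  induction r with
  | zero => simp [tables, IsTable, IsNormalized, distinctSum, polyEval]
  | succ r ih =>
    have extend : ∀ (L : List (List ℕ × ℕ)) (T : List (List ℕ × List ℤ)), IsTable x T →
        IsTable x (L.foldl (fun T t => tableExtend s (tables s r) T t.1) T) := by
      intro L
      induction L with
      | nil => exact fun T hT => hT
      | cons t L ihL =>
        intro T hT
        refine ihL _ ?_
        change IsTable x (tableExtend s (tables s r) T t.1)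
        unfold tableExtend
        split
        · rename_i p hp
          intro u hu
          rcases List.mem_cons.1 hu with rfl | hu
          · exact isNormalized_tableEntry hs ih hT hp
          · exact hT u hu
        · exact hT
    intro T hT
    rcases List.mem_cons.1 (by simpa only [tables] using hT) with rfl | hT
    · exact extend _ _ (by simp [IsTable])
    · exact ih T hT

theorem expansionValue_momentSum {x : α → ℝ} {T : List (List ℕ × List ℤ)} (hT : IsTable x T)
    {L : List (List ℕ × ℕ)} {p : List ℤ} (h : momentSum T L = some p) :
    expansionValue
        (fun l => distinctSum x l ∅ ^ 2 / (Fintype.card α).descFactorial l.length) L =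
      polyEval (Fintype.card α) p := by
  induction L generalizing p with
  | nil =>
    simp only [momentSum, Option.some.injEq] at h
    simp [← h, polyEval, expansionValue]
  | cons t L ih =>
    rw [momentSum] at h
    split at h
    · rename_i q u hq hu
      rw [Option.some.injEq] at h
      have h₁ := hT.find hq
      rw [IsNormalized] at h₁
      have h₂ := ih hu
      rw [expansionValue] at h₂ ⊢
      rw [List.map_cons, List.sum_cons, h₂, h₁, ← h, polyEval_add, polyEval_scale, polyEval_mul,
        polyEval_mul, polyEval_falling]
      -- If the falling factorial vanishes, both `0 / 0 = 0` and `(n)_ℓ E ^ 2` are zero.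
      rcases eq_or_ne ((Fintype.card α).descFactorial t.1.length : ℝ) 0 with h0 | h0
      · simp [h0]
      · field_simp; push_cast; ring
    · simp at h

/-- The sum over the expansion of a power, in closed form. -/
theorem expansionValue_momentPoly {x : α → ℝ} {s : ℕ → Option (List ℤ)}
    (hs : ∀ k u, s k = some u → ∑ i, x i ^ k = polyEval (Fintype.card α) u) {r : ℕ} {p : List ℤ}
    (h : momentPoly s r = some p) :
    expansionValue
        (fun l => distinctSum x l ∅ ^ 2 / (Fintype.card α).descFactorial l.length)
        (powerExpansion r) =
      polyEval (Fintype.card α) p := by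
  refine expansionValue_momentSum ?_ h
  rw [List.getD_eq_getElem?_getD]
  cases hg : (tables s r)[0]? with
  | none => simp [IsTable]
  | some U => exact isTable_of_mem_tables hs r U (List.mem_of_getElem? hg)

end DistinctSum

/-! ### Sums over injective tuples and their averages over permutations -/

section Embeddings

variable {α : Type*} [Fintype α] [DecidableEq α]

/-- The sum of `∏ b, x_{i_b} ^ e_b` over the embeddings `i` of the positions into the indices. -/
noncomputable def embeddingSum {m : ℕ} (x : α → ℝ) (e : Fin m → ℕ) : ℝ :=
  ∑ i : Fin m ↪ α, ∏ b, x (i b) ^ e b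

/-- Writing injectivity as an indicator on all functions lets `Fin.consEquiv` split off the first
index; the excluded set `s` records the indices already used. -/
theorem sum_injective_eq_distinctSum (x : α → ℝ) (l : List ℕ) (s : Finset α) :
    (∑ f : Fin l.length → α, if Function.Injective f ∧ ∀ b, f b ∉ s
      then ∏ b, x (f b) ^ l.get b else 0) = distinctSum x l s := by
  induction l generalizing s with
  | nil => simp [distinctSum, Function.injective_of_subsingleton]
  | cons k l ih =>
    refine ((Fin.consEquiv fun _ : Fin (l.length + 1) => α).sum_comp
      (fun f : Fin (l.length + 1) → α => if Function.Injective f ∧ ∀ b, f b ∉ s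
        then ∏ b, x (f b) ^ (k :: l).get b else 0)).symm.trans ?_
    rw [distinctSum, Fintype.sum_prod_type, ← Finset.sum_subset (Finset.subset_univ sᶜ)]
    · refine Finset.sum_congr rfl fun a ha => ?_
      rw [← ih, Finset.mul_sum]
      refine Finset.sum_congr rfl fun g _ => ?_
      have : (Function.Injective (Fin.cons a g : Fin (l.length + 1) → α) ∧
          ∀ b, (Fin.cons a g : Fin (l.length + 1) → α) b ∉ s) ↔
          Function.Injective g ∧ ∀ b, g b ∉ insert a s := by
        rw [Fin.cons_injective_iff, Fin.forall_fin_succ]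
        simp only [Fin.cons_zero, Fin.cons_succ, Finset.mem_insert, not_or, Set.mem_range,
          not_exists, forall_and]
        have := Finset.mem_compl.1 ha
        tauto
      by_cases h : Function.Injective g ∧ ∀ b, g b ∉ insert a s
      · rw [if_pos h]
        refine (if_pos (this.2 h)).trans ?_
        exact (Fin.prod_univ_succ (n := l.length) _).trans (by simp)
      · rw [if_neg h, mul_zero]
        exact if_neg fun h' => h (this.1 h')
    · intro a _ ha
      refine Finset.sum_eq_zero fun g _ => if_neg fun h => ?_
      exact ha (by simpa [Fin.consEquiv] using h.2 0)

theorem embeddingSum_eq_distinctSum (x : α → ℝ) (l : List ℕ) :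
    embeddingSum x l.get = distinctSum x l ∅ := by
  rw [← sum_injective_eq_distinctSum, embeddingSum]
  simp only [Finset.notMem_empty, not_false_eq_true, implies_true, and_true]
  rw [← Finset.sum_filter, ← (Equiv.subtypeInjectiveEquivEmbedding _ _).sum_comp,
    Finset.sum_subtype _ (p := fun f : Fin l.length → α => Function.Injective f) (by simp)]
  rfl

/-- A uniform random permutation makes the positions of distinct indices uniform. -/
theorem sum_perm_embedding {m : ℕ} (i : Fin m ↪ α) (f : (Fin m ↪ α) → ℝ) :
    (Fintype.card (Fin m ↪ α) : ℝ) * ∑ π : Equiv.Perm α, f (i.trans π.toEmbedding) =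
      (Fintype.card α).factorial * ∑ j, f j := by
  have const : ∀ j : Fin m ↪ α, ∑ π : Equiv.Perm α, f (j.trans π.toEmbedding) =
      ∑ π : Equiv.Perm α, f (i.trans π.toEmbedding) := by
    intro j
    -- The symmetric group is transitive on injective tuples; translating `π` by `g` moves `i` to
    -- `j`.
    obtain ⟨g, hg⟩ := Equiv.Perm.exists_smul_eq_embedding i j
    rw [← hg]
    exact Equiv.sum_comp (Equiv.mulRight g) (fun π : Equiv.Perm α => f (i.trans π.toEmbedding))
  calc _ = ∑ j : Fin m ↪ α, ∑ π : Equiv.Perm α, f (j.trans π.toEmbedding) := by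
        rw [Finset.sum_congr rfl fun j _ => const j]; simp
    _ = ∑ π : Equiv.Perm α, ∑ j : Fin m ↪ α, f (j.trans π.toEmbedding) := Finset.sum_comm
    _ = ∑ π : Equiv.Perm α, ∑ j, f j := by
        refine Finset.sum_congr rfl fun π _ => ?_
        exact (Equiv.embeddingCongr (Equiv.refl _) π).sum_comp f
    _ = _ := by simp [Fintype.card_perm]

/-- For each tuple `i` the summand factors into a part in `i` and a part in `π ∘ i`. The mean of the
latter does not depend on `i`, which produces the square. -/
theorem sum_perm_embeddingSum {m : ℕ} (x : α → ℝ) (e : Fin m → ℕ) :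
    ∑ π : Equiv.Perm α, embeddingSum (fun a => x a * x (π a)) e =
      (Fintype.card α).factorial *
        (embeddingSum x e ^ 2 / (Fintype.card α).descFactorial m) := by
  have hcard : Fintype.card (Fin m ↪ α) = (Fintype.card α).descFactorial m := by
    rw [Fintype.card_embedding_eq, Fintype.card_fin]
  simp only [embeddingSum]
  rw [Finset.sum_comm]
  rcases isEmpty_or_nonempty (Fin m ↪ α) with h | h
  · simp
  have hpos : (Fintype.card (Fin m ↪ α) : ℝ) ≠ 0 := by
    exact_mod_cast Fintype.card_ne_zero
  rw [← hcard, mul_div_assoc', eq_div_iff hpos, mul_comm, Finset.mul_sum, sq, Finset.sum_mul,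
    Finset.mul_sum]
  refine Finset.sum_congr rfl fun i _ => ?_
  have := sum_perm_embedding i (fun j => ∏ b, x (j b) ^ e b)
  simp only [mul_pow, Finset.prod_mul_distrib, ← Finset.mul_sum]
  rw [mul_left_comm]
  refine Eq.trans ?_ (mul_left_comm _ _ _)
  rw [← this]
  rfl

/-- The mean of a power of the permutation statistic, through the expansion of the power. -/
theorem sum_perm_pow_eq_expansionValue (x : α → ℝ) (r : ℕ) :
    ∑ π : Equiv.Perm α, (∑ a, x a * x (π a)) ^ r =
      (Fintype.card α).factorial * expansionValue
        (fun l => distinctSum x l ∅ ^ 2 / (Fintype.card α).descFactorial l.length)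
        (powerExpansion r) := by
  have linear : ∀ T : List (List ℕ × ℕ),
      ∑ π : Equiv.Perm α, expansionValue (distinctSum (fun a => x a * x (π a)) · ∅) T =
      (Fintype.card α).factorial * expansionValue
        (fun l => distinctSum x l ∅ ^ 2 / (Fintype.card α).descFactorial l.length) T := by
    intro T
    induction T with
    | nil => simp [expansionValue]
    | cons t T ih =>
      simp only [expansionValue, List.map_cons, List.sum_cons, Finset.sum_add_distrib] at ih ⊢
      rw [ih, ← Finset.mul_sum]
      simp only [← embeddingSum_eq_distinctSum]
      rw [sum_perm_embeddingSum]
      ring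
  rw [← linear]
  exact Finset.sum_congr rfl fun π _ => (expansionValue_powerExpansion _ r).symm

/-! ### The multinomial theorem, grouped by partitions -/

omit [DecidableEq α] in
theorem prod_extend {m : ℕ} (i : Fin m ↪ α) (e : Fin m → ℕ) {R : Type*} [CommMonoid R]
    (g : α → ℕ → R) (hg : ∀ a, g a 0 = 1) :
    ∏ a, g a (Function.extend i e 0 a) = ∏ b, g (i b) (e b) := by
  refine (Fintype.prod_of_injective i i.injective _ _ (fun a ha => ?_) fun b => ?_).symm
  · rw [Function.extend_apply' _ _ _ (by simpa using ha), Pi.zero_apply, hg]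
  · rw [i.injective.extend_apply]

theorem filter_map_extend {m : ℕ} (i : Fin m ↪ α) {e : Fin m → ℕ} (he : ∀ b, e b ≠ 0) :
    ((Finset.univ.val.map (Function.extend i e 0)).filter (· ≠ 0)) = Finset.univ.val.map e := by
  rw [Multiset.filter_map]
  have : (Finset.univ.val.filter ((· ≠ 0) ∘ Function.extend i e 0)) =
      (Finset.univ.map i).val := by
    rw [← Finset.filter_val]
    congr 1
    ext a
    simp only [Finset.mem_filter, Finset.mem_univ, true_and, Function.comp, Finset.mem_map]
    constructor
    · intro ha
      by_contra h
      exact ha (by rw [Function.extend_apply' _ _ _ h]; rfl)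
    · rintro ⟨b, rfl⟩
      rw [i.injective.extend_apply]
      exact he b
  rw [this, Finset.map_val, Multiset.map_map]
  refine Multiset.map_congr rfl fun b _ => ?_
  exact i.injective.extend_apply _ _ _

omit [DecidableEq α] in
-- Equal multisets of values mean that `e` and `k` on its support have fibres of equal size;
-- bijections of the fibres glue to the embedding.
theorem exists_extend_eq {m : ℕ} {e : Fin m → ℕ} {k : α → ℕ}
    (h : (Finset.univ.val.map k).filter (· ≠ 0) = Finset.univ.val.map e) :
    ∃ i : Fin m ↪ α, Function.extend i e 0 = k := by
  have he : ∀ b, e b ≠ 0 := by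
    intro b
    have : e b ∈ (Finset.univ.val.map k).filter (· ≠ 0) := by
      rw [h]; exact Multiset.mem_map_of_mem _ (Finset.mem_univ b)
    exact (Multiset.mem_filter.1 this).2
  have hfib : ∀ c, Nonempty ({b : Fin m // e b = c} ≃ {a : {a // k a ≠ 0} // k a = c}) := by
    intro c
    refine Fintype.card_eq.1 ?_
    rcases eq_or_ne c 0 with rfl | hc
    · have : IsEmpty {b : Fin m // e b = 0} := ⟨fun b => he b.1 b.2⟩
      have : IsEmpty {a : {a // k a ≠ 0} // k a = 0} := ⟨fun a => a.1.2 a.2⟩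
      simp
    · have h₁ := congrArg (Multiset.count c) h
      rw [Multiset.count_filter_of_pos (p := (· ≠ 0)) hc, Multiset.count_map, Multiset.count_map,
        ← Finset.filter_val, ← Finset.filter_val] at h₁
      rw [Fintype.card_subtype]
      have : Fintype.card {a : {a // k a ≠ 0} // k a = c} = Fintype.card {a // k a = c} :=
        Fintype.card_congr (Equiv.subtypeSubtypeEquivSubtype fun {a} (ha : k a = c) => ha ▸ hc)
      rw [this, Fintype.card_subtype]
      simp only [eq_comm (b := c)]
      exact h₁.symm
  let E := Equiv.ofFiberEquiv (f := e) (g := fun a : {a // k a ≠ 0} => k a)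
    fun c => (hfib c).some
  have hE : ∀ b, k (E b) = e b := fun b => 
    Equiv.ofFiberEquiv_map (f := e) (g := fun a : {a // k a ≠ 0} => k a) _ b
  refine ⟨E.toEmbedding.trans (Function.Embedding.subtype _), ?_⟩
  funext a
  by_cases ha : k a = 0
  · rw [Function.extend_apply', ha]
    · rfl
    · rintro ⟨b, hb⟩
      exact (E b).2 ((congrArg k hb).trans ha)
  · obtain ⟨b, hb⟩ := E.surjective ⟨a, ha⟩
    have : (E.toEmbedding.trans (Function.Embedding.subtype _)) b = a := by
      simp [hb]
    rw [← this, (E.toEmbedding.trans (Function.Embedding.subtype _)).injective.extend_apply,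
      ← hE b]
    rfl

/-- The embeddings counted are `i₀ ∘ σ` with `σ` in the stabilizer of `e`, a product of symmetric
groups on the fibres. Since `e` has no zeros, the extension determines the range. -/
theorem card_extend_eq {m : ℕ} {e : Fin m → ℕ} (he : ∀ b, e b ≠ 0) (i₀ : Fin m ↪ α) :
    (Finset.univ.filter fun i : Fin m ↪ α =>
      Function.extend i e 0 = Function.extend i₀ e 0).card =
      ∏ j ∈ Finset.univ.image e, ((Finset.univ.val.map e).count j).factorial := by
  have hstab := DomMulAct.stabilizer_card' e
  have hcount : ∀ j, Fintype.card {b // e b = j} = (Finset.univ.val.map e).count j := by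
    intro j
    rw [Multiset.count_map, ← Finset.filter_val, Fintype.card_subtype]
    simp only [eq_comm (a := j)]
    rfl
  simp only [hcount] at hstab
  rw [← hstab, Fintype.card_subtype]
  symm
  refine Finset.card_bij (fun σ _ => σ.toEmbedding.trans i₀) ?_ ?_ ?_
  · intro σ hσ
    simp only [Finset.mem_filter, Finset.mem_univ, true_and] at hσ ⊢
    funext a
    by_cases ha : ∃ b, i₀ b = a
    · obtain ⟨b, rfl⟩ := ha
      have h₁ : (σ.toEmbedding.trans i₀) (σ.symm b) = i₀ b := by simp
      rw [i₀.injective.extend_apply, ← h₁, (σ.toEmbedding.trans i₀).injective.extend_apply]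
      simpa using (congrFun hσ (σ.symm b)).symm
    · rw [Function.extend_apply' _ _ _ ha, Function.extend_apply']
      rintro ⟨b, hb⟩
      exact ha ⟨σ b, hb⟩
  · intro σ _ τ _ h
    ext b
    have := DFunLike.congr_fun h b
    exact congrArg Fin.val (i₀.injective this)
  · intro i hi
    simp only [Finset.mem_filter, Finset.mem_univ, true_and] at hi
    have hrange : ∀ b, ∃ c, i₀ c = i b := by
      intro b
      by_contra hc
      have := congrFun hi (i b)
      rw [i.injective.extend_apply, Function.extend_apply' _ _ _ hc] at this
      exact he b this
    choose σ hσ using hrange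
    have hinj : Function.Injective σ := fun b c hbc =>
      i.injective (by rw [← hσ b, ← hσ c, hbc])
    refine ⟨Equiv.ofBijective σ (Finite.injective_iff_bijective.1 hinj), ?_, ?_⟩
    · simp only [Finset.mem_filter, Finset.mem_univ, true_and]
      funext b
      have := congrFun hi (i b)
      rw [i.injective.extend_apply, ← hσ b, i₀.injective.extend_apply] at this
      exact this.symm
    · ext b
      exact hσ b

end Embeddings

section PartitionFormula

variable {α : Type*} [Fintype α] [DecidableEq α] {r : ℕ}

/-- The `b`-th part of a partition, in decreasing order. -/
def partExponent (lam : r.Partition) (b : Fin (len lam)) : ℕ := (partsList lam).get b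

theorem map_partExponent (lam : r.Partition) :
    Finset.univ.val.map (partExponent lam) = lam.parts := by
  rw [Fin.univ_val_map]
  exact (congrArg Multiset.ofList (List.ofFn_get (partsList lam))).trans (Multiset.sort_eq _ _)

theorem partExponent_ne_zero (lam : r.Partition) (b : Fin (len lam)) :
    partExponent lam b ≠ 0 := by
  refine (lam.parts_pos ?_).ne'
  rw [← map_partExponent lam]
  exact Multiset.mem_map_of_mem _ (Finset.mem_univ b)

/-- The exponent functions of weight `r` whose nonzero values are the parts of `lam`. -/
def shapeFiber (α : Type*) [Fintype α] [DecidableEq α] (lam : r.Partition) : Finset (α → ℕ) :=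
  (Finset.univ.piAntidiag r).filter fun k =>
    (Finset.univ.val.map k).filter (· ≠ 0) = lam.parts

/-- Every exponent function of weight `r` has exactly one shape, given by `Nat.Partition.ofSums`. -/
theorem sum_shapeFiber (f : (α → ℕ) → ℝ) :
    ∑ lam : r.Partition, ∑ k ∈ shapeFiber α lam, f k =
      ∑ k ∈ Finset.univ.piAntidiag r, f k := by
  simp only [shapeFiber, Finset.sum_filter]
  rw [Finset.sum_comm]
  refine Finset.sum_congr rfl fun k hk => ?_
  have hsum : (Finset.univ.val.map k).sum = r := (Finset.mem_piAntidiag.1 hk).1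
  have (lam : r.Partition) : (Finset.univ.val.map k).filter (· ≠ 0) = lam.parts ↔
      Nat.Partition.ofSums r _ hsum = lam := by
    rw [Nat.Partition.ext_iff, Nat.Partition.ofSums_parts]
  simp only [this, Finset.sum_ite_eq, Finset.mem_univ, if_true]

theorem extend_mem_shapeFiber (lam : r.Partition) (i : Fin (len lam) ↪ α) :
    Function.extend i (partExponent lam) 0 ∈ shapeFiber α lam := by
  have h := filter_map_extend i (partExponent_ne_zero lam)
  rw [map_partExponent] at h
  refine Finset.mem_filter.2 ⟨Finset.mem_piAntidiag.2 ⟨?_, fun _ _ => Finset.mem_univ _⟩, h⟩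
  -- `Nat.Partition.ofSums` discards zeros, so its `parts_sum` says that the filtering keeps the
  -- sum.
  exact (Nat.Partition.ofSums _ (Finset.univ.val.map _) rfl).parts_sum.symm.trans
    ((congrArg Multiset.sum h).trans lam.parts_sum)

/-- Each monomial of shape `lam` comes from `∏ j, m_j!` embeddings. This cancels the multiplicity
factorials of the coefficient and leaves the multinomial coefficient. -/
theorem partitionCoeff_mul_embeddingSum (x : α → ℝ) (lam : r.Partition) :
    partitionCoeff lam * embeddingSum x (partExponent lam) =
      ∑ k ∈ shapeFiber α lam, (Nat.multinomial Finset.univ k : ℝ) * ∏ a, x a ^ k a := by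
  have hmon (i : Fin (len lam) ↪ α) : ∏ b, x (i b) ^ partExponent lam b =
      ∏ a, x a ^ Function.extend i (partExponent lam) 0 a :=
    (prod_extend i _ (fun a j => x a ^ j) fun a => pow_zero _).symm
  rw [embeddingSum, Finset.sum_congr rfl fun i _ => hmon i,
    ← Finset.sum_fiberwise_of_maps_to fun i _ => extend_mem_shapeFiber lam i, Finset.mul_sum]
  refine Finset.sum_congr rfl fun k hk => ?_
  obtain ⟨hk₁, hk₂⟩ := Finset.mem_filter.1 hk
  obtain ⟨i₀, rfl⟩ := exists_extend_eq (hk₂.trans (map_partExponent lam).symm)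
  have hconst : ∀ i ∈ Finset.univ.filter (fun i : Fin (len lam) ↪ α =>
      Function.extend i (partExponent lam) 0 =
        Function.extend i₀ (partExponent lam) 0),
      ∏ a, x a ^ Function.extend i (partExponent lam) 0 a =
        ∏ a, x a ^ Function.extend i₀ (partExponent lam) 0 a := by
    intro i hi
    rw [(Finset.mem_filter.1 hi).2]
  have himage : Finset.univ.image (partExponent lam) = lam.parts.toFinset := by
    rw [← map_partExponent lam]
    rfl
  rw [Finset.sum_congr rfl hconst, Finset.sum_const, nsmul_eq_mul,
    card_extend_eq (partExponent_ne_zero lam), himage, map_partExponent, ← mul_assoc]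
  refine congrArg (· * _) ?_
  have hspec := Nat.multinomial_spec Finset.univ
    (Function.extend i₀ (partExponent lam) 0)
  rw [prod_extend i₀ _ (fun _ j => j.factorial) fun _ => rfl,
    (Finset.mem_piAntidiag.1 hk₁).1] at hspec
  have hcoeff : partitionCoeff lam = (r.factorial : ℝ) /
    ((∏ b : Fin (len lam), ((partExponent lam b).factorial : ℝ)) *
      ∏ j ∈ lam.parts.toFinset, ((lam.parts.count j).factorial : ℝ)) := rfl
  rw [hcoeff]
  rw [← hspec]
  push_cast
  have h₁ : (∏ b : Fin (len lam), ((partExponent lam b).factorial : ℝ)) ≠ 0 :=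
    Finset.prod_ne_zero_iff.2 fun b _ => by positivity
  have h₂ : (∏ j ∈ lam.parts.toFinset, ((lam.parts.count j).factorial : ℝ)) ≠ 0 :=
    Finset.prod_ne_zero_iff.2 fun b _ => by positivity
  field_simp

theorem sum_pow_eq_sum_partition (x : α → ℝ) (r : ℕ) :
    (∑ a, x a) ^ r = ∑ lam : r.Partition,
      partitionCoeff lam * embeddingSum x (partExponent lam) := by
  simp only [partitionCoeff_mul_embeddingSum]
  rw [sum_shapeFiber, Finset.sum_pow_eq_sum_piAntidiag]

end PartitionFormula

/-! ### Moments of Spearman's rho -/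

theorem integral_uniformPerm (n : ℕ) (f : Equiv.Perm (Fin n) → ℝ) :
    ∫ π, f π ∂(uniformPerm n) = (n.factorial : ℝ)⁻¹ * ∑ π, f π := by
  rw [uniformPerm, PMF.integral_eq_sum, Finset.mul_sum]
  simp [Fintype.card_perm]

theorem rhoMoment_eq_sum (n r : ℕ) :
    rhoMoment n r = (n.factorial : ℝ)⁻¹ * ∑ π, rho n π ^ r :=
  integral_uniformPerm n _

theorem rhoMoment_eq_sum_partition (n r : ℕ) :
    rhoMoment n r = normConst n ^ r * ∑ lam : r.Partition,
      partitionCoeff lam * (distinctPowerSum n lam ^ 2 / (n.descFactorial (len lam) : ℝ)) := by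
  have hfac : (n.factorial : ℝ) ≠ 0 := by positivity
  simp only [rhoMoment_eq_sum, rho, mul_pow, ← Finset.mul_sum, sum_pow_eq_sum_partition]
  rw [Finset.sum_comm, mul_left_comm, Finset.mul_sum]
  congr 1
  refine Finset.sum_congr rfl fun lam _ => ?_
  rw [← Finset.mul_sum, sum_perm_embeddingSum, Fintype.card_fin, mul_left_comm,
    inv_mul_cancel_left₀ hfac]
  rfl

theorem rhoMoment_eq_expansionValue (n r : ℕ) :
    (30030 : ℝ) ^ (2 * r) * rhoMoment n r = normConst n ^ r * expansionValue
      (fun l => distinctSum (fun i => 30030 * centeredRank n i) l ∅ ^ 2 / n.descFactorial l.length)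
      (powerExpansion r) := by
  have hfac : (n.factorial : ℝ) ≠ 0 := by positivity
  have h := sum_perm_pow_eq_expansionValue (fun i => 30030 * centeredRank n i) r
  rw [Fintype.card_fin] at h
  have hscale (π : Equiv.Perm (Fin n)) :
      ∑ i, 30030 * centeredRank n i * (30030 * centeredRank n (π i)) =
        30030 ^ 2 * ∑ i, centeredRank n i * centeredRank n (π i) := by
    rw [Finset.mul_sum]
    exact Finset.sum_congr rfl fun i _ => by ring
  simp only [hscale, mul_pow, ← Finset.mul_sum, ← pow_mul] at h
  simp only [rhoMoment_eq_sum, rho, mul_pow, ← Finset.mul_sum]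
  rw [mul_left_comm _ (normConst n ^ r), mul_left_comm _ (normConst n ^ r),
    mul_left_comm _ ((n.factorial : ℝ)⁻¹), h, inv_mul_cancel_left₀ hfac]

/-! ### Power sums of the centered ranks -/

theorem centeredRank_rev (n : ℕ) (i : Fin n) : centeredRank n i.rev = -centeredRank n i := by
  have := i.isLt
  rw [centeredRank, centeredRank, Fin.val_rev, Nat.cast_sub (by omega)]
  push_cast
  ring

theorem sum_centeredRank_odd (n : ℕ) {k : ℕ} (hk : Odd k) :
    ∑ i : Fin n, centeredRank n i ^ k = 0 := by
  have h := Equiv.sum_comp Fin.revPerm (fun i : Fin n => centeredRank n i ^ k)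
  simp only [Fin.revPerm_apply, centeredRank_rev, hk.neg_pow, Finset.sum_neg_distrib] at h
  linarith

/-- Summation of a power of the centered ranks by an odd function whose central differences are
known. -/
theorem sum_centeredRank_pow (n k : ℕ) (c : ℝ) (P : ℝ → ℝ) (hodd : ∀ y, P (-y) = -P y)
    (hP : ∀ y, P (y + 1) - P (y - 1) = 2 * (c * (y / 2)) ^ k) :
    ∑ i : Fin n, (c * centeredRank n i) ^ k = P n := by
  -- Twice the centered rank of `j` is `2 * j + 1 - n`, the midpoint of consecutive sample points.
  -- The sum telescopes to `P n - P (-n) = 2 * P n`.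
  have h := Finset.sum_range_sub (fun j : ℕ => P (2 * j - n)) n
  rw [Finset.sum_range] at h
  have hterm (i : Fin n) : P (2 * ((i : ℕ) + 1 : ℕ) - n) - P (2 * (i : ℕ) - n) =
      2 * (c * centeredRank n i) ^ k := by
    have := hP (2 * (i : ℕ) + 1 - n)
    rw [show (2 * ((i : ℕ) : ℝ) + 1 - n + 1) = 2 * ((i : ℕ) + 1 : ℕ) - n by push_cast; ring,
      show (2 * ((i : ℕ) : ℝ) + 1 - n - 1) = 2 * (i : ℕ) - n by ring] at this
    rw [this, centeredRank]
    congr 3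
    ring
  simp only [hterm, ← Finset.mul_sum, Nat.cast_zero, mul_zero, zero_sub, hodd] at h
  rw [show 2 * (n : ℝ) - n = n by ring] at h
  linarith

theorem sum_rank_pow (n k : ℕ) (u : List ℤ) (h : rankPowerSum k = some u) :
    ∑ i : Fin n, (30030 * centeredRank n i) ^ k = polyEval n u := by
  have hodd (k : ℕ) (hk : Odd k) (h : some [] = some u) :
      ∑ i : Fin n, (30030 * centeredRank n i) ^ k = polyEval n u := by
    rw [← Option.some.inj h]
    simp [mul_pow, ← Finset.mul_sum, sum_centeredRank_odd n hk, polyEval]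
  unfold rankPowerSum at h
  split at h
  case h_13 => cases h
  all_goals first
    | exact hodd _ (by decide) h
    | rw [← Option.some.inj h]
      refine sum_centeredRank_pow n _ 30030 (fun y => polyEval y _) (fun y => ?_) fun y => ?_ <;>
        (simp only [polyScale, List.map_cons, List.map_nil, polyEval]; norm_num; try ring)

/-! ### Closed forms -/

theorem pow_mul_rhoMoment_eq_polyEval (n : ℕ) {r : ℕ} {p : List ℤ}
    (h : momentPoly rankPowerSum r = some p) :
    (30030 : ℝ) ^ (2 * r) * rhoMoment n r = normConst n ^ r * polyEval n p := by
  have h₁ := expansionValue_momentPoly (x := fun i : Fin n => 30030 * centeredRank n i)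
    (by simpa only [Fintype.card_fin] using sum_rank_pow n) h
  simp only [Fintype.card_fin] at h₁
  rw [rhoMoment_eq_expansionValue, h₁]

/-- Equality of coefficient lists up to trailing zeros. -/
def polyEq (p q : List ℤ) : Bool := (polyAdd p (polyScale (-1) q)).all (· == 0)

theorem polyEval_eq_of_polyEq (x : ℝ) {p q : List ℤ} (h : polyEq p q = true) :
    polyEval x p = polyEval x q := by
  have zero (u : List ℤ) (hu : u.all (· == 0) = true) : polyEval x u = 0 := by
    induction u with
    | nil => rfl
    | cons c u ih =>
      simp only [List.all_cons, Bool.and_eq_true, beq_iff_eq] at hu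
      simp [polyEval, hu.1, ih hu.2]
  have := zero _ h
  rw [polyEval_add, polyEval_scale] at this
  push_cast at this
  linarith

/-- The coefficient list of `X ^ 3 (X - 1) (X + 1) ^ 3`. -/
def clearingPoly : List ℤ := polyMul (polyPow [0, 1] 3) (polyMul [-1, 1] (polyPow [1, 1] 3))

theorem polyEval_clearingPoly (x : ℝ) :
    polyEval x clearingPoly = x ^ 3 * (x - 1) * (x + 1) ^ 3 := by
  simp only [clearingPoly, polyEval_mul, polyEval_pow, polyEval]
  push_cast
  ring

/-- The coefficient list of `P6`. -/
def coeffP6 : List ℤ := [-28800, 44160, 54280, -50081, -22783, 23818, -178, -4361, 1225]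

/-- The coefficient list of `Q4`. -/
def coeffQ4 : List ℤ :=
  [-12700800, 9858240, 28279440, -20519664, -32726710, 8558537, 12836468, -3105081, -2236650,
    857943, 93952, -99575, 17500]

/-- The coefficient list of `Q6`. -/
def coeffQ6 : List ℤ :=
  [-101439305560276992000, 37528151745373470720, 270499002102369976320, -56314087053512122368,
    -313861911687028044288, 34634552355461373696, 206938856876542180608, -19996738740525207104,
    -95698023681505100946, 4444828679768649627, 27750786105920376371, -1409441833203864570,
    -5189139972464602944, 596842447834386253, 610987613264235129, -143066811467638476,
    -33663135573263722, 16913917053629829, -1171932384888603, -656132617822682, 204016193881500,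
    -26956502698125, 1576158959375]

theorem polyEval_coeffP6 (x : ℝ) : polyEval x coeffP6 = P6 x := by
  simp only [coeffP6, polyEval, P6]
  push_cast
  ring

theorem polyEval_coeffQ4 (x : ℝ) : polyEval x coeffQ4 = Q4 x := by
  simp only [coeffQ4, polyEval, Q4]
  push_cast
  ring

theorem polyEval_coeffQ6 (x : ℝ) : polyEval x coeffQ6 = Q6 x := by
  simp only [coeffQ6, polyEval, Q6]
  push_cast
  ring

theorem momentPoly_four : (momentPoly rankPowerSum 4).any (fun p =>
    polyEq (polyScale (25 * 12 ^ 4) p)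
      (polyScale (30030 ^ 8 * 3) (polyMul [72, -35, -38, 25] clearingPoly))) = true := by
  decide +kernel

theorem momentPoly_six : (momentPoly rankPowerSum 6).any (fun p =>
    polyEq (polyScale (245 * 12 ^ 6) p)
      (polyScale (30030 ^ 12 * 3) (polyMul coeffP6 clearingPoly))) = true := by
  decide +kernel

theorem momentPoly_eight : (momentPoly rankPowerSum 8).any (fun p =>
    (momentPoly rankPowerSum 4).any fun q =>
      polyEq (polyScale (4375 * 12 ^ 8) (polyAdd p (polyScale (-1) (polyMul q q))))
        (polyScale (30030 ^ 16 * 24) (polyMul [-2, 1] (polyMul coeffQ4 clearingPoly)))) =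
      true := by
  decide +kernel

theorem momentPoly_twelve : (momentPoly rankPowerSum 12).any (fun p =>
    (momentPoly rankPowerSum 6).any fun q =>
      polyEq (polyScale (2789661875 * 12 ^ 12) (polyAdd p (polyScale (-1) (polyMul q q))))
        (polyScale (30030 ^ 24 * 18) (polyMul [-2, 1] (polyMul coeffQ6 clearingPoly)))) =
      true := by
  decide +kernel

/-- With `r = m + 3`, `normConst n ^ r` has denominator `(n (n - 1) (n + 1)) ^ r`. The stated
denominators lack exactly the factor `n ^ 3 (n - 1) (n + 1) ^ 3` of it, the same for `r = 4, 6, 8,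
12`; this is why `clearingPoly` serves all four. -/
theorem eq_div_of_normConst {n : ℕ} (hn : 2 ≤ n) (m : ℕ) {V S K N : ℝ} (hK : K ≠ 0)
    (hV : (30030 : ℝ) ^ (2 * (m + 3)) * V = normConst n ^ (m + 3) * S)
    (hS : K * 12 ^ (m + 3) * S =
      30030 ^ (2 * (m + 3)) * (N * ((n : ℝ) ^ 3 * (n - 1) * (n + 1) ^ 3))) :
    V = N / (K * (n : ℝ) ^ m * ((n : ℝ) - 1) ^ (m + 2) * ((n : ℝ) + 1) ^ m) := by
  have hn' : (2 : ℝ) ≤ n := by exact_mod_cast hn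
  have h₀ : (n : ℝ) ≠ 0 := by positivity
  have h₁ : (n : ℝ) - 1 ≠ 0 := by linarith
  have h₂ : (n : ℝ) + 1 ≠ 0 := by positivity
  have hc : normConst n * (n * (n - 1) * (n + 1)) = 12 := by
    rw [normConst, show (n : ℝ) * ((n : ℝ) ^ 2 - 1) = n * (n - 1) * (n + 1) by ring]
    field_simp
  have hA : (30030 : ℝ) ^ (2 * (m + 3)) ≠ 0 := by positivity
  rw [eq_div_iff (by positivity)]
  refine mul_left_cancel₀ (mul_ne_zero hA (mul_ne_zero (mul_ne_zero (pow_ne_zero 3 h₀) h₁)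
    (pow_ne_zero 3 h₂))) ?_
  rw [← hc, mul_pow] at hS
  generalize (n : ℝ) - 1 = u at *
  generalize (n : ℝ) + 1 = v at *
  linear_combination (K * (n * u * v) ^ (m + 3)) * hV + hS

theorem rhoMoment_four {n : ℕ} (hn : 2 ≤ n) : rhoMoment n 4 =
    3 * (25 * (n : ℝ) ^ 3 - 38 * (n : ℝ) ^ 2 - 35 * (n : ℝ) + 72) /
      (25 * (n : ℝ) * ((n : ℝ) - 1) ^ 3 * ((n : ℝ) + 1)) := by
  obtain ⟨p, hp, h⟩ := (Option.any_eq_true _ _).1 momentPoly_four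
  have hS := polyEval_eq_of_polyEq n h
  simp only [polyEval_scale, polyEval_mul, polyEval_clearingPoly, polyEval] at hS
  push_cast at hS
  have := eq_div_of_normConst hn 1 (by norm_num) (pow_mul_rhoMoment_eq_polyEval n hp)
    (N := 3 * (25 * (n : ℝ) ^ 3 - 38 * (n : ℝ) ^ 2 - 35 * (n : ℝ) + 72)) (K := 25)
    (by linear_combination hS)
  rwa [pow_one, pow_one] at this

theorem rhoMoment_six {n : ℕ} (hn : 2 ≤ n) : rhoMoment n 6 =
    3 * P6 n / (245 * (n : ℝ) ^ 3 * ((n : ℝ) - 1) ^ 5 * ((n : ℝ) + 1) ^ 3) := by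
  obtain ⟨p, hp, h⟩ := (Option.any_eq_true _ _).1 momentPoly_six
  have hS := polyEval_eq_of_polyEq n h
  simp only [polyEval_scale, polyEval_mul, polyEval_clearingPoly, polyEval_coeffP6] at hS
  push_cast at hS
  exact eq_div_of_normConst hn 3 (by norm_num) (pow_mul_rhoMoment_eq_polyEval n hp)
    (by linear_combination hS)

theorem pow_mul_sub_sq_eq_polyEval (n : ℕ) {r : ℕ} {p q : List ℤ}
    (hp : momentPoly rankPowerSum (2 * r) = some p) (hq : momentPoly rankPowerSum r = some q) :
    (30030 : ℝ) ^ (2 * (2 * r)) * (rhoMoment n (2 * r) - rhoMoment n r ^ 2) =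
      normConst n ^ (2 * r) * (polyEval n p - polyEval n q ^ 2) := by
  have h₁ := pow_mul_rhoMoment_eq_polyEval n hp
  have h₂ := congrArg (· ^ 2) (pow_mul_rhoMoment_eq_polyEval n hq)
  simp only [mul_pow, ← pow_mul, mul_comm _ 2] at h₂
  linear_combination h₁ - h₂

theorem rhoMoment_eight_sub {n : ℕ} (hn : 2 ≤ n) : rhoMoment n 8 - rhoMoment n 4 ^ 2 =
    24 * ((n : ℝ) - 2) * Q4 n /
      (4375 * (n : ℝ) ^ 5 * ((n : ℝ) - 1) ^ 7 * ((n : ℝ) + 1) ^ 5) := by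
  obtain ⟨p, hp, h⟩ := (Option.any_eq_true _ _).1 momentPoly_eight
  obtain ⟨q, hq, h⟩ := (Option.any_eq_true _ _).1 h
  have hS := polyEval_eq_of_polyEq n h
  simp only [polyEval_scale, polyEval_mul, polyEval_add, polyEval_clearingPoly, polyEval_coeffQ4,
    polyEval] at hS
  push_cast at hS
  exact eq_div_of_normConst hn 5 (by norm_num) (pow_mul_sub_sq_eq_polyEval n (r := 4) hp hq)
    (by linear_combination hS)

theorem rhoMoment_twelve_sub {n : ℕ} (hn : 2 ≤ n) : rhoMoment n 12 - rhoMoment n 6 ^ 2 =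
    18 * ((n : ℝ) - 2) * Q6 n /
      (2789661875 * (n : ℝ) ^ 9 * ((n : ℝ) - 1) ^ 11 * ((n : ℝ) + 1) ^ 9) := by
  obtain ⟨p, hp, h⟩ := (Option.any_eq_true _ _).1 momentPoly_twelve
  obtain ⟨q, hq, h⟩ := (Option.any_eq_true _ _).1 h
  have hS := polyEval_eq_of_polyEq n h
  simp only [polyEval_scale, polyEval_mul, polyEval_add, polyEval_clearingPoly, polyEval_coeffQ6,
    polyEval] at hS
  push_cast at hS
  exact eq_div_of_normConst hn 9 (by norm_num) (pow_mul_sub_sq_eq_polyEval n (r := 6) hp hq)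
    (by linear_combination hS)

theorem variance_rho_pow (n k : ℕ) :
    ProbabilityTheory.variance (fun π => rho n π ^ k) (uniformPerm n) =
      rhoMoment n (k * 2) - rhoMoment n k ^ 2 := by
  have : IsProbabilityMeasure (uniformPerm n) := by
    unfold uniformPerm
    infer_instance
  rw [ProbabilityTheory.variance_eq_sub MemLp.of_discrete]
  simp only [rhoMoment, pow_mul, Pi.pow_apply]

end SpearmanMoments
/-- Exact moments of Spearman's rho. In the partition identity the falling factorial
`n (n - 1) ⋯ (n - ℓ(λ) + 1)` vanishes if `ℓ(λ) > n`; there are then no `ℓ(λ)` distinct indices,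
so `D_λ(n) = 0` too, and the term is `0`. -/
theorem mainTheorem5 (n : ℕ) (hn : 2 ≤ n) :
    (∀ r : ℕ,
      SpearmanMoments.rhoMoment n r =
        ((n.factorial : ℝ))⁻¹ * ∑ π : Equiv.Perm (Fin n), SpearmanMoments.rho n π ^ r) ∧
    (∀ r : ℕ,
      SpearmanMoments.rhoMoment n r =
        SpearmanMoments.normConst n ^ r *
          ∑ lam : r.Partition,
            SpearmanMoments.partitionCoeff lam *
              (SpearmanMoments.distinctPowerSum n lam ^ 2 /
                (n.descFactorial (SpearmanMoments.len lam) : ℝ))) ∧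
    SpearmanMoments.rhoMoment n 4 =
      3 * (25 * (n : ℝ) ^ 3 - 38 * (n : ℝ) ^ 2 - 35 * (n : ℝ) + 72) /
        (25 * (n : ℝ) * ((n : ℝ) - 1) ^ 3 * ((n : ℝ) + 1)) ∧
    SpearmanMoments.rhoMoment n 6 =
      3 * SpearmanMoments.P6 n /
        (245 * (n : ℝ) ^ 3 * ((n : ℝ) - 1) ^ 5 * ((n : ℝ) + 1) ^ 3) ∧
    (ProbabilityTheory.variance (fun π => SpearmanMoments.rho n π ^ 4)
        (SpearmanMoments.uniformPerm n) =
      SpearmanMoments.rhoMoment n 8 - SpearmanMoments.rhoMoment n 4 ^ 2) ∧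
    (ProbabilityTheory.variance (fun π => SpearmanMoments.rho n π ^ 4)
        (SpearmanMoments.uniformPerm n) =
      24 * ((n : ℝ) - 2) * SpearmanMoments.Q4 n /
        (4375 * (n : ℝ) ^ 5 * ((n : ℝ) - 1) ^ 7 * ((n : ℝ) + 1) ^ 5)) ∧
    (ProbabilityTheory.variance (fun π => SpearmanMoments.rho n π ^ 6)
        (SpearmanMoments.uniformPerm n) =
      SpearmanMoments.rhoMoment n 12 - SpearmanMoments.rhoMoment n 6 ^ 2) ∧
    (ProbabilityTheory.variance (fun π => SpearmanMoments.rho n π ^ 6)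
        (SpearmanMoments.uniformPerm n) =
      18 * ((n : ℝ) - 2) * SpearmanMoments.Q6 n /
        (2789661875 * (n : ℝ) ^ 9 * ((n : ℝ) - 1) ^ 11 * ((n : ℝ) + 1) ^ 9)) := by
  open SpearmanMoments in
  exact ⟨rhoMoment_eq_sum n, rhoMoment_eq_sum_partition n, rhoMoment_four hn, rhoMoment_six hn,
    variance_rho_pow n 4, (variance_rho_pow n 4).trans (rhoMoment_eight_sub hn),
    variance_rho_pow n 6, (variance_rho_pow n 6).trans (rhoMoment_twelve_sub hn)⟩
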